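/- Let $n\ge 1$, let $f(x)=x_1x_2\cdots x_n$ on the box $B=[-1,1]^n$, and for $g\colon B\to\mathbb{R}$ let $\mathrm{graph}(g)=\{(x,g(x)) : x\in B\}$. For $X\subseteq B\times\mathbb{R}$ define the error $\mathrm{err}(X)=\max_{(x,w)\in X}|w-f(x)|$. Let $\mathrm{vex}\,f$ be the convex envelope of $f$ over $B$ (the pointwise supremum of all convex functions $g$ on $B$ with $g\le f$ on $B$) and $\mathrm{cav}\,f$ the concave envelope of $f$ over $B$ (the pointwise infimum of all concave functions $g$ on $B$ with $g\ge f$ on $B$). Then the following maxima exist and $$\mathrm{err}(\mathrm{graph}(\mathrm{cav}\,f))=\mathrm{err}(\mathrm{graph}(\mathrm{vex}\,f))=\mathrm{err}(\mathrm{conv}(\mathrm{graph}(f)))=1+\left(\frac{n-2}{n}\right)^{n}.$$ For $I\subseteq\{1,\dots,n\}$ let $(x^I,w^I)$ be the reflection of the point $\left(\frac{n-2}{n},\dots,\frac{n-2}{n},-1\right)$ along $I$, that is, $x^I_i=-\frac{n-2}{n}$ for $i\in I$, $x^I_i=\frac{n-2}{n}$ for $i\notin I$, and $w^I=-(-1)^{|I|}$.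 The maximum error is attained at every one of these reflections: for every $I$, $(x^I,w^I)\in\mathrm{conv}(\mathrm{graph}(f))$ and $|w^I-f(x^I)|=1+\left(\frac{n-2}{n}\right)^{n}$; moreover $(x^I,w^I)$ lies on $\mathrm{graph}(\mathrm{vex}\,f)$ if $|I|$ is even and on $\mathrm{graph}(\mathrm{cav}\,f)$ if $|I|$ is odd. If $n\ne 2$, these are $2^n$ distinct points. -/

import Mathlib

/-- `e` is the error of `X` with respect to `f`: the maximum (attained) of `|w - f x|` over
`(x, w) ∈ X`. -/
def IsError {E : Type*} (f : E → ℝ) (X : Set (E × ℝ)) (e : ℝ) : Prop :=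
  IsGreatest ((fun p : E × ℝ => |p.2 - f p.1|) '' X) e

/-- The convex envelope of `f` over `S`: the pointwise supremum of all convex underestimators. It is
meant for points of `S` and for `f` bounded below on a convex set `S` (the set is then non-empty,
and bounded above by `f x`). -/
noncomputable def convexEnvelope {E : Type*} [AddCommGroup E] [Module ℝ E]
    (S : Set E) (f : E → ℝ) (x : E) : ℝ :=
  sSup {t : ℝ | ∃ g : E → ℝ, ConvexOn ℝ S g ∧ (∀ y ∈ S, g y ≤ f y) ∧ g x = t}

/-- The concave envelope of `f` over `S`: the pointwise infimum of all concave overestimators. -/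
noncomputable def concaveEnvelope {E : Type*} [AddCommGroup E] [Module ℝ E]
    (S : Set E) (f : E → ℝ) (x : E) : ℝ :=
  sInf {t : ℝ | ∃ g : E → ℝ, ConcaveOn ℝ S g ∧ (∀ y ∈ S, f y ≤ g y) ∧ g x = t}

/-- The multilinear monomial `x₁ ⋯ xₙ`. -/
def multilin (n : ℕ) (x : Fin n → ℝ) : ℝ := ∏ i, x i

/-- The box `[-1, 1]ⁿ`. -/
def symBox (n : ℕ) : Set (Fin n → ℝ) := Set.Icc (fun _ => -1) (fun _ => 1)

/-- The reflection of `(x, w)` along `I`: reverse the sign of `x i` for `i ∈ I`, and replace `w` by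
`-w` if `I` has odd size. -/
def reflection {n : ℕ} (I : Finset (Fin n)) (p : (Fin n → ℝ) × ℝ) : (Fin n → ℝ) × ℝ :=
  (fun i => if i ∈ I then -p.1 i else p.1 i, (-1) ^ I.card * p.2)

/-- The point `((n-2)/n, …, (n-2)/n, -1)`. -/
noncomputable def basePoint (n : ℕ) : (Fin n → ℝ) × ℝ :=
  (fun _ => ((n : ℝ) - 2) / n, -1)

/-!
The error of the convex envelope is controlled by two families of affine minorants of
`f x = ∏ i, x i` on the box: the constant `-1`, and `x ↦ ∑ i, s i * x i - (n - 1)` for sign vectors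
`s` with `∏ i, s i = 1` (`sum_sub_le_prod`). At a point `x` with `f x > 0`, take for `s` the signs of
the coordinates of `x`, and let `A` be the mean of the `|x i|`. By AM-GM `f x ≤ A ^ n`, so the
distance from `f x` to the better of the two minorants is at most
`A ^ n - max (-1) (n * A - (n - 1))`, which is largest at the crossing point `A = (n - 2) / n`
(`pow_sub_max_le`). Where `f x ≤ 0`, the constant `-1` suffices, except for `n = 1`, where `f` is
affine. The resulting bound is `exists_convex_minorant`. Reversing one coordinate changes the sign of
`f`, which transfers the bound to concave majorants (`exists_concave_majorant`).

A point `(x, w)` of the convex hull of the graph satisfies `g x ≤ w ≤ h x` for all convex minorants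
`g` and concave majorants `h`, so the same bound holds on the hull. It is attained because the
base point is the average of the `n` points of the graph over the vertices of the box with exactly
one coordinate `-1`; the reflections are linear symmetries of the graph.
-/

/-! ### Envelopes and the convex hull of a graph -/

section Envelope

variable {E : Type*} [AddCommGroup E] [Module ℝ E] {S : Set E} {f g : E → ℝ} {x : E}

lemma le_convexEnvelope (hx : x ∈ S) (hg : ConvexOn ℝ S g) (hgf : ∀ y ∈ S, g y ≤ f y) :
    g x ≤ convexEnvelope S f x :=
  le_csSup ⟨f x, by rintro _ ⟨h, -, hh, rfl⟩; exact hh x hx⟩ ⟨g, hg, hgf, rfl⟩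

lemma concaveEnvelope_le (hx : x ∈ S) (hg : ConcaveOn ℝ S g) (hfg : ∀ y ∈ S, f y ≤ g y) :
    concaveEnvelope S f x ≤ g x :=
  csInf_le ⟨f x, by rintro _ ⟨h, -, hh, rfl⟩; exact hh x hx⟩ ⟨g, hg, hfg, rfl⟩

lemma ConvexOn.le_of_mem_convexHull_graphOn (hg : ConvexOn ℝ S g) (hgf : ∀ y ∈ S, g y ≤ f y)
    {p : E × ℝ} (hp : p ∈ convexHull ℝ (S.graphOn f)) : p.1 ∈ S ∧ g p.1 ≤ p.2 := by
  refine convexHull_min ?_ hg.convex_epigraph hp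
  rintro _ ⟨y, hy, rfl⟩
  exact ⟨hy, hgf y hy⟩

lemma ConcaveOn.le_of_mem_convexHull_graphOn (hg : ConcaveOn ℝ S g) (hfg : ∀ y ∈ S, f y ≤ g y)
    {p : E × ℝ} (hp : p ∈ convexHull ℝ (S.graphOn f)) : p.1 ∈ S ∧ p.2 ≤ g p.1 := by
  refine convexHull_min ?_ hg.convex_hypograph hp
  rintro _ ⟨y, hy, rfl⟩
  exact ⟨hy, hfg y hy⟩

/-- Existence of a convex minorant is needed: `sSup ∅ = 0` in `ℝ`. -/
lemma convexEnvelope_le_of_mem_convexHull_graphOn (hg : ConvexOn ℝ S g) (hgf : ∀ y ∈ S, g y ≤ f y)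
    {p : E × ℝ} (hp : p ∈ convexHull ℝ (S.graphOn f)) : convexEnvelope S f p.1 ≤ p.2 := by
  refine csSup_le ⟨_, g, hg, hgf, rfl⟩ ?_
  rintro _ ⟨h, hh, hhf, rfl⟩
  exact (hh.le_of_mem_convexHull_graphOn hhf hp).2

/-- Existence of a concave majorant is needed: `sInf ∅ = 0` in `ℝ`. -/
lemma le_concaveEnvelope_of_mem_convexHull_graphOn (hg : ConcaveOn ℝ S g)
    (hfg : ∀ y ∈ S, f y ≤ g y) {p : E × ℝ} (hp : p ∈ convexHull ℝ (S.graphOn f)) :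
    p.2 ≤ concaveEnvelope S f p.1 := by
  refine le_csInf ⟨_, g, hg, hfg, rfl⟩ ?_
  rintro _ ⟨h, hh, hhf, rfl⟩
  exact (hh.le_of_mem_convexHull_graphOn hhf hp).2

end Envelope

/-! ### Real inequalities -/

/-- Equivalently `1 - ∏ y i ≤ ∑ (1 - y i)`, by induction from
`1 - a * b ≤ (1 - a) + (1 - b)` for `a, b ≤ 1`. -/
lemma sum_sub_le_prod {ι : Type*} (s : Finset ι) (y : ι → ℝ) (hy : ∀ i ∈ s, |y i| ≤ 1) :
    ∑ i ∈ s, y i - (s.card - 1) ≤ ∏ i ∈ s, y i := by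
  classical
  induction s using Finset.induction_on with
  | empty => simp
  | insert a s ha ih =>
    have hs : ∀ i ∈ s, |y i| ≤ 1 := fun i hi => hy i (Finset.mem_insert_of_mem hi)
    have h1 : ∏ i ∈ s, y i ≤ 1 := by
      refine (le_abs_self _).trans ?_
      rw [Finset.abs_prod]
      exact Finset.prod_le_one (fun _ _ => abs_nonneg _) hs
    have h2 : y a ≤ 1 := (abs_le.1 (hy a (Finset.mem_insert_self _ _))).2
    rw [Finset.sum_insert ha, Finset.prod_insert ha, Finset.card_insert_of_notMem ha]
    push_cast
    nlinarith [ih hs, mul_nonneg (sub_nonneg.2 h1) (sub_nonneg.2 h2)]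

lemma pow_sub_pow_le_mul_sub {a b : ℝ} (ha : 0 ≤ a) (hab : a ≤ b) (hb : b ≤ 1) (n : ℕ) :
    b ^ n - a ^ n ≤ n * (b - a) := by
  induction n with
  | zero => simp
  | succ n ih =>
    have h1 : a ^ n ≤ 1 := pow_le_one₀ ha (hab.trans hb)
    have h2 : a ^ n ≤ b ^ n := pow_le_pow_left₀ ha hab n
    push_cast
    rw [pow_succ, pow_succ]
    nlinarith [mul_nonneg (sub_nonneg.2 h1) (sub_nonneg.2 hab),
      mul_nonneg (sub_nonneg.2 hb) (sub_nonneg.2 h2)]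

lemma prod_le_mean_pow {n : ℕ} (hn : 1 ≤ n) (y : Fin n → ℝ) (hy : ∀ i, 0 ≤ y i) :
    ∏ i, y i ≤ ((∑ i, y i) / n) ^ n := by
  have hn' : (n : ℝ) ≠ 0 := by positivity
  have h := Real.geom_mean_le_arith_mean_weighted Finset.univ (fun _ => 1 / (n : ℝ)) y
    (fun _ _ => by positivity) (by simp [hn']) fun i _ => hy i
  rw [← Finset.mul_sum, one_div_mul_eq_div] at h
  calc ∏ i, y i = (∏ i, y i ^ (1 / (n : ℝ))) ^ n := by
        rw [← Finset.prod_pow]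
        refine Finset.prod_congr rfl fun i _ => ?_
        rw [one_div, Real.rpow_inv_natCast_pow (hy i) (by omega)]
    _ ≤ _ := pow_le_pow_left₀ (Finset.prod_nonneg fun i _ => Real.rpow_nonneg (hy i) _) h n

/-- The gap between `A ^ n` and the larger of the two affine minorants is largest where the two
minorants cross, at `A = (n - 2) / n`. -/
lemma pow_sub_max_le {n : ℕ} (hn : 1 ≤ n) {A : ℝ} (h0 : 0 ≤ A) (h1 : A ≤ 1) :
    A ^ n - max (-1) (n * A - (n - 1)) ≤ 1 + (((n : ℝ) - 2) / n) ^ n := by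
  have hn' : (n : ℝ) ≠ 0 := by positivity
  obtain rfl | hn2 : n = 1 ∨ 2 ≤ n := by omega
  · norm_num
  have ha : 0 ≤ ((n : ℝ) - 2) / n :=
    div_nonneg (sub_nonneg.2 (by exact_mod_cast hn2)) (by positivity)
  have hna : n * (((n : ℝ) - 2) / n) = n - 2 := by field_simp
  rcases le_total A (((n : ℝ) - 2) / n) with h | h
  · linarith [pow_le_pow_left₀ h0 h n, le_max_left (-1) (n * A - (n - 1 : ℝ))]
  · linarith [pow_sub_pow_le_mul_sub ha h h1 n, le_max_right (-1) (n * A - (n - 1 : ℝ))]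

/-! ### Affine bounds for the product on the box -/

lemma mem_symBox_iff {n : ℕ} {x : Fin n → ℝ} : x ∈ symBox n ↔ ∀ i, |x i| ≤ 1 := by
  simp only [symBox, Set.mem_Icc, Pi.le_def, abs_le, forall_and]

lemma convex_symBox (n : ℕ) : Convex ℝ (symBox n) := convex_Icc _ _

lemma abs_multilin_le_one {n : ℕ} {x : Fin n → ℝ} (hx : x ∈ symBox n) : |multilin n x| ≤ 1 := by
  rw [multilin, Finset.abs_prod]
  exact Finset.prod_le_one (fun _ _ => abs_nonneg _) fun i _ => mem_symBox_iff.1 hx i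

lemma convexOn_signed_sum {n : ℕ} (s : Fin n → ℝ) :
    ConvexOn ℝ (symBox n) fun x => ∑ i, s i * x i - (n - 1) := by
  refine ⟨convex_symBox n, fun x _ y _ a b _ _ hab => le_of_eq ?_⟩
  obtain rfl : b = 1 - a := by linarith
  simp only [Pi.add_apply, Pi.smul_apply, smul_eq_mul, mul_add, Finset.sum_add_distrib,
    mul_left_comm _ a, mul_left_comm _ (1 - a), ← Finset.mul_sum, mul_sub]
  ring

lemma signed_sum_le_multilin {n : ℕ} {s : Fin n → ℝ} (hs : ∀ i, |s i| = 1) (hp : ∏ i, s i = 1)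
    {x : Fin n → ℝ} (hx : x ∈ symBox n) : ∑ i, s i * x i - (n - 1) ≤ multilin n x := by
  have h := sum_sub_le_prod Finset.univ (fun i => s i * x i) fun i _ => by
    rw [abs_mul, hs, one_mul]
    exact mem_symBox_iff.1 hx i
  rwa [Finset.prod_mul_distrib, hp, one_mul, Finset.card_univ, Fintype.card_fin] at h

lemma exists_signs {n : ℕ} {x : Fin n → ℝ} (hx : 0 < multilin n x) :
    ∃ s : Fin n → ℝ, (∀ i, |s i| = 1) ∧ ∏ i, s i = 1 ∧ ∀ i, s i * x i = |x i| := by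
  have h0 : ∀ i, x i ≠ 0 := fun i => Finset.prod_ne_zero_iff.1 hx.ne' i (Finset.mem_univ i)
  refine ⟨fun i => x i / |x i|, fun i => ?_, ?_, fun i => ?_⟩
  · rw [abs_div, abs_abs, div_self (abs_ne_zero.2 (h0 i))]
  · rw [Finset.prod_div_distrib, ← Finset.abs_prod]
    change multilin n x / |multilin n x| = 1
    rw [abs_of_pos hx, div_self hx.ne']
  · rw [div_mul_eq_mul_div, ← abs_mul_abs_self, mul_self_div_self]

lemma exists_convex_minorant {n : ℕ} (hn : 1 ≤ n) {x : Fin n → ℝ} (hx : x ∈ symBox n) :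
    ∃ g : (Fin n → ℝ) → ℝ, ConvexOn ℝ (symBox n) g ∧ (∀ y ∈ symBox n, g y ≤ multilin n y) ∧
      multilin n x - g x ≤ 1 + (((n : ℝ) - 2) / n) ^ n := by
  have hn' : (n : ℝ) ≠ 0 := by positivity
  rcases le_or_gt (multilin n x) 0 with h | h
  · obtain rfl | hn2 : n = 1 ∨ 2 ≤ n := by omega
    -- for `n = 1` the minorant with `s = 1` is the function itself
    · refine ⟨_, convexOn_signed_sum fun _ => 1,
        fun y hy => signed_sum_le_multilin (by simp) (by simp) hy, ?_⟩
      simp [multilin]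
      norm_num
    · refine ⟨fun _ => -1, convexOn_const _ (convex_symBox n),
        fun y hy => (abs_le.1 (abs_multilin_le_one hy)).1, ?_⟩
      have ha : 0 ≤ ((n : ℝ) - 2) / n :=
        div_nonneg (sub_nonneg.2 (by exact_mod_cast hn2)) (by positivity)
      linarith [pow_nonneg ha n]
  · obtain ⟨s, hs, hp, hsx⟩ := exists_signs h
    refine ⟨fun y => max (-1) (∑ i, s i * y i - (n - 1)),
      (convexOn_const _ (convex_symBox n)).sup (convexOn_signed_sum s),
      fun y hy => max_le (abs_le.1 (abs_multilin_le_one hy)).1 (signed_sum_le_multilin hs hp hy), ?_⟩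
    have hA1 : (∑ i, |x i|) / n ≤ 1 := by
      rw [div_le_one (by positivity)]
      simpa using Finset.sum_le_card_nsmul Finset.univ (fun i => |x i|) 1
        fun i _ => mem_symBox_iff.1 hx i
    have h1 := pow_sub_max_le hn (by positivity) hA1
    have h2 := prod_le_mean_pow hn (fun i => |x i|) fun i => abs_nonneg _
    rw [← Finset.abs_prod] at h2
    rw [mul_div_cancel₀ _ hn'] at h1
    simp only [hsx]
    have h3 : multilin n x ≤ |∏ i, x i| := le_abs_self _
    linarith

/-! ### Reflections -/

lemma isLinearMap_reflection {n : ℕ} (I : Finset (Fin n)) :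
    IsLinearMap ℝ (reflection I) where
  map_add p q := by
    refine Prod.ext (funext fun i => ?_) (mul_add _ _ _)
    by_cases hi : i ∈ I <;> simp [reflection, hi, add_comm]
  map_smul c p := by
    refine Prod.ext (funext fun i => ?_) (mul_left_comm _ _ _)
    by_cases hi : i ∈ I <;> simp [reflection, hi]

lemma multilin_reflection {n : ℕ} (I : Finset (Fin n)) (p : (Fin n → ℝ) × ℝ) :
    multilin n (reflection I p).1 = (-1) ^ I.card * multilin n p.1 := by
  have h : ∀ i, (reflection I p).1 i = (if i ∈ I then -1 else 1) * p.1 i := fun i => by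
    by_cases hi : i ∈ I <;> simp [reflection, hi]
  simp only [multilin, h, Finset.prod_mul_distrib]
  simp

lemma reflection_fst_mem_symBox {n : ℕ} (I : Finset (Fin n)) {p : (Fin n → ℝ) × ℝ}
    (hp : p.1 ∈ symBox n) : (reflection I p).1 ∈ symBox n := by
  rw [mem_symBox_iff] at hp ⊢
  intro i
  by_cases hi : i ∈ I <;> simpa [reflection, hi] using hp i

lemma reflection_mem_graphOn {n : ℕ} (I : Finset (Fin n)) {p : (Fin n → ℝ) × ℝ}
    (hp : p ∈ (symBox n).graphOn (multilin n)) :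
    reflection I p ∈ (symBox n).graphOn (multilin n) := by
  obtain ⟨y, hy, rfl⟩ := hp
  exact ⟨_, reflection_fst_mem_symBox I (p := (y, multilin n y)) hy,
    Prod.ext rfl (multilin_reflection I _)⟩

lemma reflection_mem_convexHull {n : ℕ} (I : Finset (Fin n)) {p : (Fin n → ℝ) × ℝ}
    (hp : p ∈ convexHull ℝ ((symBox n).graphOn (multilin n))) :
    reflection I p ∈ convexHull ℝ ((symBox n).graphOn (multilin n)) := by
  have h := (isLinearMap_reflection I).image_convexHull ((symBox n).graphOn (multilin n))
  refine convexHull_mono ?_ (h ▸ Set.mem_image_of_mem _ hp)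
  rintro _ ⟨q, hq, rfl⟩
  exact reflection_mem_graphOn I hq

/-- A convex minorant at the point with one coordinate reversed yields, after reversing that
coordinate and the sign of the value, a concave majorant. -/
lemma exists_concave_majorant {n : ℕ} (hn : 1 ≤ n) {x : Fin n → ℝ} (hx : x ∈ symBox n) :
    ∃ g : (Fin n → ℝ) → ℝ, ConcaveOn ℝ (symBox n) g ∧ (∀ y ∈ symBox n, multilin n y ≤ g y) ∧
      g x - multilin n x ≤ 1 + (((n : ℝ) - 2) / n) ^ n := by
  let I : Finset (Fin n) := {⟨0, hn⟩}
  let R : (Fin n → ℝ) →ₗ[ℝ] (Fin n → ℝ) :=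
    LinearMap.fst ℝ _ ℝ ∘ₗ (isLinearMap_reflection I).mk' _ ∘ₗ LinearMap.inl ℝ _ ℝ
  have hR : ∀ y ∈ symBox n, R y ∈ symBox n := fun y hy =>
    reflection_fst_mem_symBox I (p := (y, 0)) hy
  have hf : ∀ y, multilin n (R y) = -multilin n y := fun y => by
    have h := multilin_reflection I (y, 0)
    rwa [Finset.card_singleton, pow_one, neg_one_mul] at h
  obtain ⟨g, hg, hgf, hgx⟩ := exists_convex_minorant hn (hR x hx)
  refine ⟨fun y => -g (R y),
    ((hg.comp_linearMap R).subset hR (convex_symBox n)).neg, fun y hy => ?_, ?_⟩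
  · linarith [hgf _ (hR y hy), hf y]
  · linarith [hf x]

/-! ### The base point -/

lemma basePoint_mem_convexHull {n : ℕ} (hn : 1 ≤ n) :
    basePoint n ∈ convexHull ℝ ((symBox n).graphOn (multilin n)) := by
  have hn' : (n : ℝ) ≠ 0 := by positivity
  -- the vertices of the box with exactly one coordinate equal to `-1`
  let v : Fin n → (Fin n → ℝ) := fun j i => if i = j then -1 else 1
  have hv : ∀ j, (v j, (-1 : ℝ)) ∈ (symBox n).graphOn (multilin n) := fun j => by
    refine ⟨v j, mem_symBox_iff.2 fun i => ?_, Prod.ext rfl ?_⟩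
    · by_cases hi : i = j <;> simp [v, hi]
    · simp [v, multilin]
  have h : basePoint n = ∑ j : Fin n, (1 / n : ℝ) • (v j, (-1 : ℝ)) := by
    refine Prod.ext (funext fun i => ?_) ?_
    · have hs : ∑ j : Fin n, v j i = n - 2 := by
        have : ∀ j, v j i = 1 - (if i = j then 2 else 0) := fun j => by
          by_cases hi : i = j <;> simp [v, hi]; norm_num
        simp [this]
      simp only [basePoint, Prod.fst_sum, Prod.smul_fst, Finset.sum_apply, Pi.smul_apply,
        smul_eq_mul, ← Finset.mul_sum, hs]
      ring
    · simp [basePoint, Prod.snd_sum, hn']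
  rw [h]
  exact (convex_convexHull ℝ _).sum_mem (fun _ _ => by positivity) (by simp [hn'])
    fun j _ => subset_convexHull ℝ _ (hv j)

lemma abs_sub_two_div_le_one {n : ℕ} (hn : 1 ≤ n) : |((n : ℝ) - 2) / n| ≤ 1 := by
  have : (1 : ℝ) ≤ n := by exact_mod_cast hn
  rw [abs_div, Nat.abs_cast, div_le_one (by linarith), abs_le]
  constructor <;> linarith

lemma abs_reflection_basePoint_sub {n : ℕ} (hn : 1 ≤ n) (I : Finset (Fin n)) :
    |(reflection I (basePoint n)).2 - multilin n (reflection I (basePoint n)).1| =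
      1 + (((n : ℝ) - 2) / n) ^ n := by
  rw [multilin_reflection]
  have h1 : multilin n (basePoint n).1 = (((n : ℝ) - 2) / n) ^ n := by
    simp [multilin, basePoint, div_pow]
  have h2 : |(((n : ℝ) - 2) / n) ^ n| ≤ 1 := by
    rw [abs_pow]
    exact pow_le_one₀ (abs_nonneg _) (abs_sub_two_div_le_one hn)
  rw [h1, reflection, basePoint, ← mul_sub, abs_mul, abs_neg_one_pow, one_mul, ← abs_neg,
    abs_of_nonneg (by linarith [(abs_le.1 h2).1]), neg_sub, sub_neg_eq_add, add_comm]

lemma reflection_basePoint_injective {n : ℕ} (hn : 1 ≤ n) (hn2 : n ≠ 2) :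
    Function.Injective fun I : Finset (Fin n) => reflection I (basePoint n) := by
  have ha : ((n : ℝ) - 2) / n ≠ 0 :=
    div_ne_zero (sub_ne_zero.2 (by exact_mod_cast hn2)) (by positivity)
  intro I J h
  ext i
  have hi := congrFun (congrArg Prod.fst h) i
  by_cases h1 : i ∈ I <;> by_cases h2 : i ∈ J <;>
    simp only [reflection, basePoint, h1, h2, if_true, if_false] at hi ⊢
  · exact absurd hi (fun h => ha (by linarith))
  · exact absurd hi (fun h => ha (by linarith))

/-! ### The maximal errors -/

theorem mainTheorem7 (n : ℕ) (hn : 1 ≤ n) :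
    IsError (multilin n) ((symBox n).graphOn (concaveEnvelope (symBox n) (multilin n)))
      (1 + (((n : ℝ) - 2) / n) ^ n) ∧
    IsError (multilin n) ((symBox n).graphOn (convexEnvelope (symBox n) (multilin n)))
      (1 + (((n : ℝ) - 2) / n) ^ n) ∧
    IsError (multilin n) (convexHull ℝ ((symBox n).graphOn (multilin n)))
      (1 + (((n : ℝ) - 2) / n) ^ n) ∧
    (∀ I : Finset (Fin n),
      reflection I (basePoint n) ∈ convexHull ℝ ((symBox n).graphOn (multilin n)) ∧
      |(reflection I (basePoint n)).2 - multilin n (reflection I (basePoint n)).1| =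
        1 + (((n : ℝ) - 2) / n) ^ n ∧
      (Even I.card → reflection I (basePoint n) ∈
        (symBox n).graphOn (convexEnvelope (symBox n) (multilin n))) ∧
      (Odd I.card → reflection I (basePoint n) ∈
        (symBox n).graphOn (concaveEnvelope (symBox n) (multilin n)))) ∧
    (n ≠ 2 →
      (Set.range fun I : Finset (Fin n) => reflection I (basePoint n)).ncard = 2 ^ n) := by
  have hvex : ConvexOn ℝ (symBox n) fun _ => (-1 : ℝ) := convexOn_const _ (convex_symBox n)
  have hcav : ConcaveOn ℝ (symBox n) fun _ => (1 : ℝ) := concaveOn_const _ (convex_symBox n)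
  have hlow : ∀ y ∈ symBox n, -1 ≤ multilin n y := fun y hy =>
    (abs_le.1 (abs_multilin_le_one hy)).1
  have hupp : ∀ y ∈ symBox n, multilin n y ≤ 1 := fun y hy =>
    (abs_le.1 (abs_multilin_le_one hy)).2
  have hhull : ∀ I, reflection I (basePoint n) ∈ convexHull ℝ ((symBox n).graphOn (multilin n)) :=
    fun I => reflection_mem_convexHull I (basePoint_mem_convexHull hn)
  have hbox : ∀ p ∈ convexHull ℝ ((symBox n).graphOn (multilin n)), p.1 ∈ symBox n :=
    fun p hp => (hvex.le_of_mem_convexHull_graphOn hlow hp).1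
  have heven : ∀ I : Finset (Fin n), Even I.card → reflection I (basePoint n) ∈
      (symBox n).graphOn (convexEnvelope (symBox n) (multilin n)) := fun I hI => by
    have hw : (reflection I (basePoint n)).2 = -1 := by simp [reflection, basePoint, hI.neg_one_pow]
    have h1 := convexEnvelope_le_of_mem_convexHull_graphOn hvex hlow (hhull I)
    have h2 := le_convexEnvelope (hbox _ (hhull I)) hvex hlow
    exact ⟨_, hbox _ (hhull I), Prod.ext rfl (le_antisymm h1 (hw ▸ h2))⟩
  have hodd : ∀ I : Finset (Fin n), Odd I.card → reflection I (basePoint n) ∈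
      (symBox n).graphOn (concaveEnvelope (symBox n) (multilin n)) := fun I hI => by
    have hw : (reflection I (basePoint n)).2 = 1 := by simp [reflection, basePoint, hI.neg_one_pow]
    have h1 := le_concaveEnvelope_of_mem_convexHull_graphOn hcav hupp (hhull I)
    have h2 := concaveEnvelope_le (hbox _ (hhull I)) hcav hupp
    exact ⟨_, hbox _ (hhull I), Prod.ext rfl (le_antisymm (hw ▸ h2) h1)⟩
  have hself : ∀ x ∈ symBox n, (x, multilin n x) ∈
      convexHull ℝ ((symBox n).graphOn (multilin n)) := fun x hx =>
    subset_convexHull ℝ _ ⟨x, hx, rfl⟩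
  have hvexgap : ∀ x ∈ symBox n, multilin n x - convexEnvelope (symBox n) (multilin n) x ≤
      1 + (((n : ℝ) - 2) / n) ^ n := fun x hx => by
    obtain ⟨g, hg, hgf, hgx⟩ := exists_convex_minorant hn hx
    linarith [le_convexEnvelope hx hg hgf]
  have hcavgap : ∀ x ∈ symBox n, concaveEnvelope (symBox n) (multilin n) x - multilin n x ≤
      1 + (((n : ℝ) - 2) / n) ^ n := fun x hx => by
    obtain ⟨g, hg, hgf, hgx⟩ := exists_concave_majorant hn hx
    linarith [concaveEnvelope_le hx hg hgf]
  refine ⟨⟨?_, ?_⟩, ⟨?_, ?_⟩, ⟨?_, ?_⟩, fun I => ⟨hhull I, abs_reflection_basePoint_sub hn I,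
    heven I, hodd I⟩, fun hn2 => ?_⟩
  · exact ⟨_, hodd {⟨0, hn⟩} (by simp), abs_reflection_basePoint_sub hn _⟩
  · rintro _ ⟨_, ⟨x, hx, rfl⟩, rfl⟩
    have h := le_concaveEnvelope_of_mem_convexHull_graphOn hcav hupp (hself x hx)
    exact (abs_of_nonneg (sub_nonneg.2 h)).trans_le (hcavgap x hx)
  · exact ⟨_, heven ∅ (by simp), abs_reflection_basePoint_sub hn _⟩
  · rintro _ ⟨_, ⟨x, hx, rfl⟩, rfl⟩
    have h := convexEnvelope_le_of_mem_convexHull_graphOn hvex hlow (hself x hx)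
    exact ((abs_of_nonpos (sub_nonpos.2 h)).trans (neg_sub _ _)).trans_le (hvexgap x hx)
  · exact ⟨_, hhull ∅, abs_reflection_basePoint_sub hn _⟩
  · rintro _ ⟨p, hp, rfl⟩
    have h1 := convexEnvelope_le_of_mem_convexHull_graphOn hvex hlow hp
    have h2 := le_concaveEnvelope_of_mem_convexHull_graphOn hcav hupp hp
    have h3 := hvexgap p.1 (hbox p hp)
    have h4 := hcavgap p.1 (hbox p hp)
    exact abs_le.2 ⟨by linarith, by linarith⟩
  · rw [← Set.image_univ, Set.ncard_image_of_injective _ (reflection_basePoint_injective hn hn2),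
      Set.ncard_univ, Nat.card_eq_fintype_card, Fintype.card_finset, Fintype.card_fin]
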